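/- Let $G$ be a locally compact (Hausdorff) second countable group, $\Gamma<G$ a uniform lattice (a discrete subgroup with $G/\Gamma$ compact), and $X$ a complete separable CAT(0) space with a $\Gamma$-action by isometries. Let $\mathscr F\subseteq G$ be a relatively compact Borel fundamental domain for the action of $\Gamma$ on $G$ by right multiplication such that $\{\eta\in\Gamma:\mathscr F\eta\cap C\neq\varnothing\}$ is finite for every compact $C\subseteq G$, and let $dg$ be the Haar measure on $G$ normalized so that $\mathscr F$ has measure $1$. Let $L^{[2]}(G,X)^\Gamma$ be the space of measurable maps $f:G\to X$ with separable range, modulo null sets, such that $f(g\gamma^{-1})=\gamma f(g)$ for all $g\in G$, $\gamma\in\Gamma$, and such that $g\mapsto d(f(g),x)$ is in $L^2(\mathscr F)$ for some (hence any) $x\in X$; endow it with the metric $$d(f,f')=\Big(\int_{\mathscr F} d^2(f(g),f'(g))\,dg\Big)^{1/2}$$ and with the $G$-action $(hf)(g)=f(h^{-1}g)$. An action of a topological group $H$ by isometries on a metric space $Y$ is called evanescent if there is an unbounded set $T\subseteq Y$ such that for every compact set $Q\subseteq H$ the set $\{d(hy,y):h\in Q,\ y\in T\}$ is bounded. If the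 $G$-action on $L^{[2]}(G,X)^\Gamma$ is evanescent, then the $\Gamma$-action on $X$ is evanescent. -/

import Mathlib

open MeasureTheory Set
open scoped ENNReal Pointwise

/-! ### CAT(0) spaces -/

/-- `σ`, restricted to `[0, dist x y]`, is a geodesic segment from `x` to `y`. -/
structure IsGeodesicSegment {X : Type*} [MetricSpace X] (σ : ℝ → X) (x y : X) : Prop where
  source : σ 0 = x
  target : σ (dist x y) = y
  isometric : ∀ s ∈ Icc 0 (dist x y), ∀ t ∈ Icc 0 (dist x y), dist (σ s) (σ t) = |s - t|

/-- A CAT(0) space: a geodesic metric space in which the midpoint of every geodesic segment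
satisfies the Bruhat-Tits inequality. -/
class IsCAT0 (X : Type*) [MetricSpace X] : Prop where
  exists_geodesic : ∀ x y : X, ∃ σ : ℝ → X, IsGeodesicSegment σ x y
  bruhat_tits : ∀ (x c c' : X) (σ : ℝ → X), IsGeodesicSegment σ c c' →
    2 * dist (σ (dist c c' / 2)) x ^ 2 ≤
      dist c' x ^ 2 + dist c x ^ 2 - 1 / 2 * dist c' c ^ 2

/-! ### Evanescent actions -/

/-- A subset `T` of a `G`-space is `Q`-evanescent if the displacements of its points by elements
of `Q` are bounded. -/
def IsEvanescentSet {G Y : Type*} [SMul G Y] [MetricSpace Y] (Q : Set G) (T : Set Y) : Prop :=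
  ∃ K : ℝ, ∀ g ∈ Q, ∀ x ∈ T, dist (g • x) x ≤ K

/-- The action of the topological group `G` on `Y` is evanescent: some unbounded set is
`Q`-evanescent for every compact `Q ⊆ G`. -/
def IsEvanescent (G Y : Type*) [Group G] [TopologicalSpace G] [MulAction G Y] [MetricSpace Y] :
    Prop :=
  ∃ T : Set Y, ¬ Bornology.IsBounded T ∧ ∀ Q : Set G, IsCompact Q → IsEvanescentSet Q T

/-! ### The induced space -/

section Induction

variable {G : Type*} [Group G] [TopologicalSpace G] [MeasurableSpace G]

/-- Relatively compact Borel fundamental domains `F` for the action of `Γ` on `G` by right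
multiplication such that only finitely many translates `F η` meet a given compact set, with
respect to a measure `μ` for which `F` has mass one. -/
structure RightFundamentalDomain (Γ : Subgroup G) (μ : Measure G) where
  carrier : Set G
  measurableSet : MeasurableSet carrier
  isFundamentalDomain : IsFundamentalDomain Γ.op carrier μ
  isCompact_closure : IsCompact (closure carrier)
  finite_meet : ∀ C : Set G, IsCompact C →
    {η : Γ | (((fun g : G => g * (η : G)) '' carrier) ∩ C).Nonempty}.Finite
  measure_eq_one : μ carrier = 1

set_option maxHeartbeats 1000000 in
/-- Normalized fundamental domains exist for every discrete cocompact subgroup. -/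
theorem RightFundamentalDomain.exists_haar [IsTopologicalGroup G] [T2Space G]
    [LocallyCompactSpace G] [SecondCountableTopology G] [BorelSpace G]
    (Γ : Subgroup G) [DiscreteTopology Γ] [CompactSpace (G ⧸ Γ)] :
    ∃ μ : Measure G, μ.IsHaarMeasure ∧ Nonempty (RightFundamentalDomain Γ μ) := by
  have : Countable Γ := TopologicalSpace.separableSpace_iff_countable.1 inferInstance
  have hclosed : IsClosed (Γ : Set G) := Γ.isClosed_of_discrete
  -- an open relatively compact `V` that embeds into the quotient
  obtain ⟨W, hW, hWΓ⟩ : ∃ W : Set G, IsOpen W ∧ W ∩ Γ = {1} := by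
    obtain ⟨W, hW, hW'⟩ := isOpen_induced_iff.1 (isOpen_discrete ({1} : Set Γ))
    refine ⟨W, hW, Set.ext fun g => ⟨fun hg => ?_, ?_⟩⟩
    · have : (⟨g, hg.2⟩ : Γ) ∈ ((↑) : Γ → G) ⁻¹' W := hg.1
      rw [hW'] at this
      exact congrArg Subtype.val this
    · rintro rfl
      have : (1 : Γ) ∈ ((↑) : Γ → G) ⁻¹' W := by rw [hW']; rfl
      exact ⟨this, Γ.one_mem⟩
  have h1W : (1 : G) ∈ W := (hWΓ.symm ▸ mem_singleton (1 : G) : (1 : G) ∈ W ∩ Γ).1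
  obtain ⟨V₀, hV₀, hV₀W⟩ : ∃ V ∈ nhds (1 : G), ∀ v ∈ V, ∀ w ∈ V, v⁻¹ * w ∈ W := by
    have hc : Filter.Tendsto (fun p : G × G => p.1⁻¹ * p.2) (nhds 1 ×ˢ nhds 1) (nhds 1) := by
      have : Continuous fun p : G × G => p.1⁻¹ * p.2 := by fun_prop
      simpa [nhds_prod_eq] using this.tendsto (1, 1)
    obtain ⟨V, hV, hVW⟩ := Filter.mem_prod_same_iff.1 (hc (hW.mem_nhds h1W))
    exact ⟨V, hV, fun v hv w hw => hVW (Set.mk_mem_prod hv hw)⟩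
  obtain ⟨K, hK, hK1⟩ := exists_compact_mem_nhds (1 : G)
  set V := interior (V₀ ∩ K) with hVdef
  have hVo : IsOpen V := isOpen_interior
  have hV1 : (1 : G) ∈ V := mem_interior_iff_mem_nhds.2 (Filter.inter_mem hV₀ hK1)
  have hVΓ : ∀ g v w : G, v ∈ g • V → w ∈ g • V → v⁻¹ * w ∈ Γ → v = w := by
    rintro g _ _ ⟨v, hv, rfl⟩ ⟨w, hw, rfl⟩ hmem
    have h2 : v⁻¹ * w ∈ W :=
      hV₀W v (interior_subset hv).1 w (interior_subset hw).1
    have h3 : v⁻¹ * w ∈ W ∩ Γ := ⟨h2, by simpa [mul_assoc] using hmem⟩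
    rw [hWΓ] at h3
    rw [inv_mul_eq_one.1 h3]
  -- finitely many translates of `V` cover the quotient
  let U : G → Set (G ⧸ Γ) := fun g => ((↑) : G → G ⧸ Γ) '' (g • V)
  have hUo : ∀ g, IsOpen (U g) := fun g => QuotientGroup.isOpenMap_coe _ (hVo.smul g)
  obtain ⟨t, ht⟩ := isCompact_univ.elim_finite_subcover U hUo (fun q _ => by
    induction q using QuotientGroup.induction_on with
    | H g => exact mem_iUnion.2 ⟨g, g, ⟨1, hV1, by simp⟩, rfl⟩)
  let e := t.equivFin
  let a : Fin t.card → G := fun i => (e.symm i : G)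
  let F : Set G := ⋃ i, (a i • V ∩ ⋂ j, ⋂ _ : j < i, {x | (x : G ⧸ Γ) ∉ U (a j)})
  have hFm : MeasurableSet F := by
    refine MeasurableSet.iUnion fun i => (hVo.smul _).measurableSet.inter ?_
    refine MeasurableSet.iInter fun j => MeasurableSet.iInter fun _ => ?_
    exact ((hUo _).preimage QuotientGroup.continuous_mk).measurableSet.compl
  have hFc : IsCompact (closure F) := by
    have hc : IsCompact (⋃ i, a i • K) := isCompact_iUnion fun i => hK.smul _
    refine hc.of_isClosed_subset isClosed_closure (closure_minimal ?_ hc.isClosed)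
    exact iUnion_mono fun i => inter_subset_left.trans
      (smul_set_mono (interior_subset.trans inter_subset_right))
  have hF : ∀ x : G, ∃! γ : Γ.op, γ • x ∈ F := by
    intro x
    have hmk : ∀ γ : Γ.op, ((γ • x : G) : G ⧸ Γ) = (x : G ⧸ Γ) := by
      rintro ⟨γ, hγ⟩
      exact QuotientGroup.mk_mul_of_mem x hγ
    have hex : ∃ i, (x : G ⧸ Γ) ∈ U (a i) := by
      obtain ⟨g, hg, hx⟩ := mem_iUnion₂.1 (ht (mem_univ (x : G ⧸ Γ)))
      exact ⟨e ⟨g, hg⟩, by simpa [a] using hx⟩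
    classical
    obtain ⟨i, hi, hmin⟩ := WellFounded.has_min (wellFounded_lt (α := Fin t.card))
      {i | (x : G ⧸ Γ) ∈ U (a i)} hex
    obtain ⟨v, hv, hvx⟩ := hi
    have hmem : x⁻¹ * v ∈ Γ := QuotientGroup.eq.1 hvx.symm
    refine ⟨⟨MulOpposite.op (x⁻¹ * v), hmem⟩, ?_, ?_⟩
    · have hxv : ((⟨MulOpposite.op (x⁻¹ * v), hmem⟩ : Γ.op) • x : G) = v := by
        change x * (x⁻¹ * v) = v
        simp
      refine mem_iUnion.2 ⟨i, by rw [hxv]; exact hv, ?_⟩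
      refine mem_iInter₂.2 fun j hj => ?_
      change ((_ : G) : G ⧸ Γ) ∉ U (a j)
      rw [hmk]
      exact fun hx => hmin j hx hj
    · rintro ⟨γ, hγ⟩ hγF
      obtain ⟨k, hk, hk'⟩ := mem_iUnion.1 hγF
      have hxk : (x : G ⧸ Γ) ∈ U (a k) := ⟨_, hk, hmk _⟩
      have hki : k = i := by
        refine le_antisymm (not_lt.1 fun hlt => ?_) (not_lt.1 fun hlt => hmin k hxk hlt)
        have := mem_iInter₂.1 hk' i hlt
        change ((_ : G) : G ⧸ Γ) ∉ U (a i) at this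
        rw [hmk] at this
        exact this ⟨v, hv, hvx⟩
      subst hki
      have hk2 : x * γ.unop ∈ a k • V := hk
      have hγ' : γ.unop ∈ Γ := hγ
      have := hVΓ _ _ _ hk2 hv (by
        have := Γ.mul_mem (Γ.inv_mem hγ') hmem
        simpa [mul_assoc] using this)
      refine Subtype.ext (MulOpposite.unop_injective ?_)
      change γ.unop = x⁻¹ * v
      rw [← this]
      simp
  -- normalization
  clear_value F
  obtain ⟨μ₀, _⟩ : ∃ μ₀ : Measure G, μ₀.IsHaarMeasure := ⟨Measure.haar, inferInstance⟩
  have hpos : μ₀ F ≠ 0 := by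
    intro h0
    have h1 : ∀ᵐ x ∂μ₀, ∀ γ : Γ, x * (γ : G) ∉ F :=
      ae_all_iff.2 fun γ => (quasiMeasurePreserving_mul_right μ₀ (γ : G)).ae
        (measure_eq_zero_iff_ae_notMem.1 h0)
    obtain ⟨x, hx⟩ := h1.exists
    obtain ⟨⟨γ, hγ⟩, hγF, -⟩ := hF x
    exact hx ⟨γ.unop, hγ⟩ hγF
  have hfin : μ₀ F ≠ ∞ := ((measure_mono subset_closure).trans_lt hFc.measure_lt_top).ne
  refine ⟨(μ₀ F)⁻¹ • μ₀, Measure.IsHaarMeasure.smul μ₀ (ENNReal.inv_ne_zero.2 hfin)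
    (ENNReal.inv_ne_top.2 hpos), ⟨⟨F, hFm, IsFundamentalDomain.mk' hFm.nullMeasurableSet hF, hFc,
      fun C hC => ?_, ?_⟩⟩⟩
  · have hcomp : IsCompact ((closure F)⁻¹ * C) := hFc.inv.mul hC
    have : IsCompact (((↑) : Γ → G) ⁻¹' ((closure F)⁻¹ * C)) :=
      hclosed.isClosedEmbedding_subtypeVal.isCompact_preimage hcomp
    refine this.finite_of_discrete.subset ?_
    rintro η ⟨_, ⟨g, hg, rfl⟩, hgC⟩
    exact ⟨g⁻¹, Set.inv_mem_inv.2 (subset_closure hg), _, hgC, by simp⟩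
  · rw [Measure.smul_apply, smul_eq_mul, ENNReal.inv_mul_cancel hpos hfin]

/-- The underlying set of the induced space `L^{[2]}(G, X)^Γ`: classes, modulo null sets, of
strongly measurable maps `f : G → X` (i.e. measurable with separable range) such that
`f (g γ⁻¹) = γ f g` and such that `g ↦ d (f g, x)` is square-integrable on the fundamental domain
for some `x`. -/
def InducedSpace {Γ : Subgroup G} {μ : Measure G} (F : RightFundamentalDomain Γ μ)
    (X : Type*) [MetricSpace X] [MulAction Γ X] : Type _ :=
  {f : G →ₘ[μ] X // (∀ γ : Γ, ∀ᵐ g ∂μ, f (g * (γ : G)⁻¹) = γ • f g) ∧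
    ∃ x : X, MemLp (fun g => dist (f g) x) 2 (μ.restrict F.carrier)}

namespace InducedSpace

variable {Γ : Subgroup G} {μ : Measure G} {F : RightFundamentalDomain Γ μ}
  {X : Type*} [MetricSpace X] [MulAction Γ X]

theorem memLp_dist_const (f : InducedSpace F X) (x : X) :
    MemLp (fun g => dist (f.1 g) x) 2 (μ.restrict F.carrier) := by
  obtain ⟨y, hy⟩ := f.2.2
  have hfin : IsFiniteMeasure (μ.restrict F.carrier) :=
    ⟨by rw [Measure.restrict_apply_univ, F.measure_eq_one]; exact ENNReal.one_lt_top⟩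
  refine (hy.add (memLp_const (dist y x))).mono
    ((f.1.aestronglyMeasurable.dist aestronglyMeasurable_const).restrict) ?_
  refine Filter.Eventually.of_forall fun g => ?_
  rw [Real.norm_of_nonneg dist_nonneg]
  exact (dist_triangle _ y _).trans (le_abs_self _)

theorem memLp_dist (f f' : InducedSpace F X) :
    MemLp (fun g => dist (f.1 g) (f'.1 g)) 2 (μ.restrict F.carrier) := by
  obtain ⟨y, hy⟩ := f.2.2
  refine (hy.add (f'.memLp_dist_const y)).mono
    ((f.1.aestronglyMeasurable.dist f'.1.aestronglyMeasurable).restrict) ?_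
  refine Filter.Eventually.of_forall fun g => ?_
  rw [Real.norm_of_nonneg dist_nonneg]
  refine (dist_triangle _ y _).trans ?_
  rw [dist_comm y]
  exact le_abs_self _

/-- The distance `(∫_F d(f(g), f'(g))² dg)^{1/2}`. -/
noncomputable instance : Dist (InducedSpace F X) where
  dist f f' := Real.sqrt (∫ g in F.carrier, dist (f.1 g) (f'.1 g) ^ 2 ∂μ)

theorem dist_def (f f' : InducedSpace F X) :
    dist f f' = Real.sqrt (∫ g in F.carrier, dist (f.1 g) (f'.1 g) ^ 2 ∂μ) := rfl

theorem dist_eq_eLpNorm (f f' : InducedSpace F X) :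
    dist f f' =
      (eLpNorm (fun g => dist (f.1 g) (f'.1 g)) 2 (μ.restrict F.carrier)).toReal := by
  rw [(memLp_dist f f').eLpNorm_eq_integral_rpow_norm two_ne_zero ENNReal.ofNat_ne_top,
    ENNReal.toReal_ofReal (by positivity), dist_def, Real.sqrt_eq_rpow]
  simp

variable [IsTopologicalGroup G] [BorelSpace G] [SecondCountableTopology G] [LocallyCompactSpace G]
  [μ.IsHaarMeasure] [DiscreteTopology Γ]

/-- Classes that agree almost everywhere on the fundamental domain agree. -/
theorem ext_of_ae_restrict (f f' : InducedSpace F X)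
    (h : ∀ᵐ g ∂μ.restrict F.carrier, f.1 g = f'.1 g) : f = f' := by
  have : Countable Γ := TopologicalSpace.separableSpace_iff_countable.1 inferInstance
  rw [ae_restrict_iff' F.measurableSet] at h
  refine Subtype.ext (AEEqFun.ext ?_)
  have h1 : ∀ᵐ g ∂μ, ∀ γ : Γ, g * (γ : G)⁻¹ ∈ F.carrier →
      f.1 (g * (γ : G)⁻¹) = f'.1 (g * (γ : G)⁻¹) :=
    ae_all_iff.2 fun γ => (quasiMeasurePreserving_mul_right μ ((γ : G)⁻¹)).ae h
  filter_upwards [F.isFundamentalDomain.ae_covers, h1, ae_all_iff.2 f.2.1, ae_all_iff.2 f'.2.1]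
    with g hg h1 h2 h3
  obtain ⟨⟨η, hη⟩, hgη⟩ := hg
  have hη' : η.unop ∈ Γ := hη
  have := h1 ⟨η.unop⁻¹, Γ.inv_mem hη'⟩ (by simpa using hgη)
  rw [h2, h3] at this
  exact smul_left_cancel _ this

noncomputable instance : MetricSpace (InducedSpace F X) where
  dist_self f := by simp [dist_def]
  dist_comm f f' := by simp [dist_def, dist_comm]
  dist_triangle f f' f'' := by
    rw [dist_eq_eLpNorm, dist_eq_eLpNorm, dist_eq_eLpNorm, ← ENNReal.toReal_add
      (memLp_dist f f').eLpNorm_ne_top (memLp_dist f' f'').eLpNorm_ne_top]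
    refine ENNReal.toReal_mono (ENNReal.add_ne_top.2
      ⟨(memLp_dist f f').eLpNorm_ne_top, (memLp_dist f' f'').eLpNorm_ne_top⟩) ?_
    refine le_trans (eLpNorm_mono_real fun g => ?_) (eLpNorm_add_le
      (memLp_dist f f').1 (memLp_dist f' f'').1 one_le_two)
    rw [Real.norm_of_nonneg dist_nonneg]
    exact dist_triangle _ _ _
  eq_of_dist_eq_zero {f f'} h := by
    refine ext_of_ae_restrict f f' ?_
    rw [dist_eq_eLpNorm, ENNReal.toReal_eq_zero_iff,
      or_iff_left (memLp_dist f f').eLpNorm_ne_top,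
      eLpNorm_eq_zero_iff (memLp_dist f f').1 two_ne_zero] at h
    filter_upwards [h] with g hg
    exact dist_eq_zero.1 hg

/-- Left translation of function classes: `(h f) g = f (h⁻¹ g)`. -/
noncomputable def translate (h : G) (f : G →ₘ[μ] X) : G →ₘ[μ] X :=
  f.compMeasurePreserving (fun g => h⁻¹ * g) (measurePreserving_mul_left μ h⁻¹)


variable [IsIsometricSMul Γ X]

theorem translate_mem (h : G) (f : InducedSpace F X) :
    (∀ γ : Γ, ∀ᵐ g ∂μ, translate h f.1 (g * (γ : G)⁻¹) = γ • translate h f.1 g) ∧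
      ∃ x : X, MemLp (fun g => dist (translate h f.1 g) x) 2 (μ.restrict F.carrier) := by
  have hae : ∀ᵐ g ∂μ, translate h f.1 g = f.1 (h⁻¹ * g) :=
    AEEqFun.coeFn_compMeasurePreserving _ _
  constructor
  · intro γ
    filter_upwards [hae, (quasiMeasurePreserving_mul_right μ ((γ : G)⁻¹)).ae hae,
      (measurePreserving_mul_left μ h⁻¹).quasiMeasurePreserving.ae (f.2.1 γ)] with g h1 h2 h3
    rw [h1, h2, ← h3, mul_assoc]
  · obtain ⟨x, -⟩ := f.2.2
    refine ⟨x, ((translate h f.1).aestronglyMeasurable.dist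
      aestronglyMeasurable_const).restrict, ?_⟩
    -- a finite set of translates covers `h⁻¹ F`
    have hC : IsCompact ((fun g => h⁻¹ * g) '' closure F.carrier) :=
      F.isCompact_closure.image (continuous_const_mul _)
    have hfin := F.finite_meet _ hC
    set A : Finset Γ := hfin.toFinset with hA
    have hcov : ∀ᵐ g ∂μ, h * g ∈ F.carrier → ∃ η ∈ A, g * (η : G)⁻¹ ∈ F.carrier := by
      filter_upwards [F.isFundamentalDomain.ae_covers] with g hg hhg
      obtain ⟨⟨η, hη⟩, hgη⟩ := hg
      have hη' : η.unop ∈ Γ := hη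
      have hgη' : g * η.unop ∈ F.carrier := hgη
      refine ⟨⟨η.unop⁻¹, Γ.inv_mem hη'⟩, ?_, by simpa using hgη'⟩
      simp only [hA, Set.Finite.mem_toFinset, Set.mem_ofPred_eq]
      exact ⟨g, ⟨_, hgη', by simp⟩, ⟨_, subset_closure hhg, by simp⟩⟩
    -- each translate carries a finite integral
    have hfinite : ∀ η : Γ, ∫⁻ g, F.carrier.indicator
        (fun k => ‖dist (f.1 k) (η • x)‖ₑ ^ (2 : ℝ)) (g * (η : G)⁻¹) ∂μ < ∞ := by
      intro η
      have h1 := (f.memLp_dist_const (η • x))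
      have h2 := lintegral_rpow_enorm_lt_top_of_eLpNorm_lt_top two_ne_zero
        ENNReal.ofNat_ne_top h1.2
      rw [ENNReal.toReal_ofNat] at h2
      have hmeas : AEMeasurable (F.carrier.indicator
          (fun k => ‖dist (f.1 k) (η • x)‖ₑ ^ (2 : ℝ))) μ :=
        ((f.1.aestronglyMeasurable.dist aestronglyMeasurable_const).enorm.pow_const _).indicator
          F.measurableSet
      have hmap := Measure.isMulLeftInvariant_eq_smul (Measure.map (· * (η : G)⁻¹) μ) μ
      rw [← lintegral_map' (f := F.carrier.indicator
          (fun k => ‖dist (f.1 k) (η • x)‖ₑ ^ (2 : ℝ))) (g := fun g => g * (η : G)⁻¹)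
        (hmeas.mono_ac (quasiMeasurePreserving_mul_right μ ((η : G)⁻¹)).absolutelyContinuous)
        (measurable_mul_const _).aemeasurable, hmap, lintegral_smul_measure,
        lintegral_indicator F.measurableSet]
      exact ENNReal.mul_lt_top ENNReal.coe_lt_top h2
    rw [eLpNorm_lt_top_iff_lintegral_rpow_enorm_lt_top two_ne_zero ENNReal.ofNat_ne_top,
      ENNReal.toReal_ofNat, ← lintegral_indicator F.measurableSet,
      ← lintegral_mul_left_eq_self _ h]
    refine lt_of_le_of_lt (lintegral_mono_ae (g := fun g => ∑ η ∈ A, F.carrier.indicator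
        (fun k => ‖dist (f.1 k) (η • x)‖ₑ ^ (2 : ℝ)) (g * (η : G)⁻¹)) ?_) ?_
    · have : Countable Γ := TopologicalSpace.separableSpace_iff_countable.1 inferInstance
      filter_upwards [hcov, (measurePreserving_mul_left μ h).quasiMeasurePreserving.ae hae,
        ae_all_iff.2 f.2.1] with g hg h1 h2
      by_cases hgF : h * g ∈ F.carrier
      · obtain ⟨η, hηA, hη⟩ := hg hgF
        refine le_trans (le_of_eq ?_) (Finset.single_le_sum (fun _ _ => zero_le) hηA)
        rw [indicator_of_mem hgF, indicator_of_mem hη, h1, h2, dist_smul, inv_mul_cancel_left]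
      · rw [indicator_of_notMem hgF]
        exact zero_le
    · rw [lintegral_finsetSum']
      · exact ENNReal.sum_lt_top.2 fun η _ => hfinite η
      · intro η _
        exact (((f.1.aestronglyMeasurable.dist
          aestronglyMeasurable_const).enorm.pow_const _).indicator
          F.measurableSet).comp_quasiMeasurePreserving
            (quasiMeasurePreserving_mul_right μ ((η : G)⁻¹))

/-- The induced `G`-action `(h f) g = f (h⁻¹ g)` on `L^{[2]}(G, X)^Γ`. -/
noncomputable instance : MulAction G (InducedSpace F X) where
  smul h f := ⟨translate h f.1, translate_mem h f⟩
  one_smul f := by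
    refine Subtype.ext ?_
    change translate 1 f.1 = f.1
    refine AEEqFun.ext ?_
    filter_upwards [AEEqFun.coeFn_compMeasurePreserving f.1
      (measurePreserving_mul_left μ (1 : G)⁻¹)] with g hg
    rw [translate, hg]
    simp
  mul_smul h k f := by
    refine Subtype.ext ?_
    change translate (h * k) f.1 = translate h (translate k f.1)
    refine AEEqFun.ext ?_
    filter_upwards [AEEqFun.coeFn_compMeasurePreserving f.1
      (measurePreserving_mul_left μ (h * k)⁻¹),
      AEEqFun.coeFn_compMeasurePreserving (translate k f.1) (measurePreserving_mul_left μ h⁻¹),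
      (measurePreserving_mul_left μ h⁻¹).quasiMeasurePreserving.ae
        (AEEqFun.coeFn_compMeasurePreserving f.1 (measurePreserving_mul_left μ k⁻¹))]
      with g h1 h2 h3
    rw [translate, h1, translate, h2]
    simp only [Function.comp_apply] at h3 ⊢
    rw [translate, h3]
    simp [mul_assoc]

end InducedSpace

end Induction

/-!
Let `T` be an unbounded set of maps whose displacements by compact subsets of `G` are bounded. For
`g` and `u` in `F`, writing `u = h * g * γ` keeps `h` in a compact set, and right translation by
`g * γ` distorts Haar measure by a bounded factor. Hence, for each `γ`, the mean over
`(g, u) ∈ F × F` of `d (γ f(u), f(g)) ^ 2` is controlled by displacements of `f`, so it is bounded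
uniformly over `f ∈ T`. As `Γ` is countable, each `f ∈ T` admits a `g ∈ F` for which the mean over
`u ∈ F` of `d (γ f(u), f(g)) ^ 2` is at most a constant `M γ` independent of `f`, for all `γ` at
once. The values `f(g)` so chosen are unbounded, since by `γ = 1` the constant map `f(g)` is at
bounded distance from `f`, and the triangle inequality through `γ f` bounds their displacement by
`γ`.
-/

open scoped NNReal

section LpEDist

variable {α X : Type*} [MeasurableSpace α] [PseudoMetricSpace X] {ν : Measure α} {p : ℝ≥0∞}

/-- The `L^p` distance, possibly infinite, between two maps to a metric space: the `L^p` seminorm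
of their pointwise distance. It is meant for comparing maps in the induced space with maps which
are not equivariant, such as constants. -/
noncomputable def lpEDist (p : ℝ≥0∞) (ν : Measure α) (f f' : α → X) : ℝ≥0∞ :=
  eLpNorm (fun a => edist (f a) (f' a)) p ν

theorem lpEDist_comm (f f' : α → X) : lpEDist p ν f f' = lpEDist p ν f' f := by
  simp only [lpEDist, edist_comm]

theorem lpEDist_congr_left {f₁ f₂ : α → X} (h : f₁ =ᵐ[ν] f₂) (f : α → X) :
    lpEDist p ν f₁ f = lpEDist p ν f₂ f :=
  eLpNorm_congr_ae (h.mono fun a ha => by simp only [ha])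

theorem lpEDist_triangle {f₁ f₂ f₃ : α → X} (h₁ : AEStronglyMeasurable f₁ ν)
    (h₂ : AEStronglyMeasurable f₂ ν) (h₃ : AEStronglyMeasurable f₃ ν) (hp : 1 ≤ p) :
    lpEDist p ν f₁ f₃ ≤ lpEDist p ν f₁ f₂ + lpEDist p ν f₂ f₃ :=
  (eLpNorm_mono_enorm fun _ => edist_triangle _ _ _).trans
    (eLpNorm_add_le (h₁.edist h₂).aestronglyMeasurable (h₂.edist h₃).aestronglyMeasurable hp)

theorem lpEDist_const [IsProbabilityMeasure ν] (hp : p ≠ 0) (x y : X) :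
    lpEDist p ν (fun _ => x) (fun _ => y) = edist x y := by
  simp [lpEDist, eLpNorm_const _ hp (IsProbabilityMeasure.ne_zero ν)]

theorem lpEDist_smul {H : Type*} [SMul H X] [IsIsometricSMul H X] (h : H) (f f' : α → X) :
    lpEDist p ν (fun a => h • f a) (fun a => h • f' a) = lpEDist p ν f f' := by
  simp only [lpEDist, edist_smul_left]

theorem lpEDist_two_sq (f f' : α → X) :
    lpEDist 2 ν f f' ^ 2 = ∫⁻ a, edist (f a) (f' a) ^ 2 ∂ν := by
  simpa [lpEDist] using eLpNorm_nnreal_pow_eq_lintegral (μ := ν) (f := fun a => edist (f a) (f' a))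
    (two_ne_zero : (2 : ℝ≥0) ≠ 0)

theorem edist_smul_le_lpEDist_add [IsProbabilityMeasure ν] {H : Type*} [SMul H X]
    [IsIsometricSMul H X] {f : α → X} (hf : AEStronglyMeasurable f ν) (hp : 1 ≤ p) (h : H)
    (x : X) :
    edist (h • x) x ≤
      lpEDist p ν f (fun _ => x) + lpEDist p ν (fun a => h • f a) (fun _ => x) := by
  have hhf : AEStronglyMeasurable (fun a => h • f a) ν :=
    (isometry_smul X h).continuous.comp_aestronglyMeasurable hf
  calc edist (h • x) x
      = lpEDist p ν (fun _ => h • x) (fun _ => x) :=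
        (lpEDist_const (one_pos.trans_le hp).ne' _ _).symm
    _ ≤ lpEDist p ν (fun _ => h • x) (fun a => h • f a) +
          lpEDist p ν (fun a => h • f a) (fun _ => x) :=
        lpEDist_triangle aestronglyMeasurable_const hhf aestronglyMeasurable_const hp
    _ = _ := by rw [lpEDist_smul, lpEDist_comm]

theorem lpEDist_le_add_edist_add [IsProbabilityMeasure ν] {f f' : α → X}
    (hf : AEStronglyMeasurable f ν) (hf' : AEStronglyMeasurable f' ν) (hp : 1 ≤ p) (x y : X) :
    lpEDist p ν f f' ≤
      lpEDist p ν f (fun _ => x) + edist x y + lpEDist p ν f' (fun _ => y) := by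
  calc lpEDist p ν f f'
      ≤ lpEDist p ν f (fun _ => y) + lpEDist p ν (fun _ => y) f' :=
        lpEDist_triangle hf aestronglyMeasurable_const hf' hp
    _ ≤ lpEDist p ν f (fun _ => x) + lpEDist p ν (fun _ => x) (fun _ => y) +
          lpEDist p ν (fun _ => y) f' := by
        gcongr
        exact lpEDist_triangle hf aestronglyMeasurable_const aestronglyMeasurable_const hp
    _ = _ := by rw [lpEDist_const (one_pos.trans_le hp).ne', lpEDist_comm _ f']

end LpEDist

theorem exists_forall_le_of_lintegral_le {α ι : Type*} [MeasurableSpace α] (ν : Measure α)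
    [IsProbabilityMeasure ν] [Countable ι] (C : ι → ℝ≥0) :
    ∃ M : ι → ℝ≥0, ∀ a : ι → α → ℝ≥0∞, (∀ i, AEMeasurable (a i) ν) →
      (∀ i, ∫⁻ x, a i x ∂ν ≤ C i) → ∃ x, ∀ i, a i x ≤ M i := by
  obtain ⟨δ, hδ, hsum⟩ := ENNReal.exists_pos_tsum_mul_lt_of_countable one_ne_zero
    (fun i => (C i : ℝ≥0∞)) fun _ => ENNReal.coe_ne_top
  refine ⟨fun i => (δ i)⁻¹, fun a ha haC => ?_⟩
  have hm : ∀ i, AEMeasurable (fun x => a i x * δ i) ν := fun i => (ha i).mul_const _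
  obtain ⟨x, hx⟩ := exists_le_lintegral (μ := ν) (f := fun x => ∑' i, a i x * δ i) (.tsum hm)
  refine ⟨x, fun i => ?_⟩
  rw [ENNReal.coe_inv (hδ i).ne', ENNReal.le_inv_iff_mul_le]
  calc a i x * δ i ≤ ∑' i, a i x * δ i := ENNReal.le_tsum (f := fun i => a i x * δ i) i
    _ ≤ ∫⁻ x, ∑' i, a i x * δ i ∂ν := hx
    _ = ∑' i, (∫⁻ x, a i x ∂ν) * δ i := by
      rw [lintegral_tsum hm]
      exact tsum_congr fun i => lintegral_mul_const'' _ (ha i)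
    _ ≤ ∑' i, (C i * δ i : ℝ≥0∞) := by gcongr with i; exact haC i
    _ ≤ 1 := hsum.le

section Haar

variable {G : Type*} [Group G] [TopologicalSpace G] [IsTopologicalGroup G] [LocallyCompactSpace G]

theorem bddAbove_modularCharacterFun_image {K : Set G} (hK : IsCompact K) :
    BddAbove (Measure.modularCharacterFun '' K) := by
  borelize G
  let μ : Measure G := Measure.haar
  obtain ⟨A, hA1, hA, hAc⟩ := exists_mem_nhds_isCompact_isClosed (1 : G)
  have hA0 : μ A ≠ 0 := (μ.measure_pos_of_mem_nhds hA1).ne'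
  have hAK : μ (A * K⁻¹) ≠ ∞ := (hA.mul hK.inv).measure_lt_top.ne
  refine ⟨(μ (A * K⁻¹) / μ A).toNNReal, ?_⟩
  rintro _ ⟨k, hk, rfl⟩
  rw [← ENNReal.coe_le_coe, ENNReal.coe_toNNReal (ENNReal.div_ne_top hAK hA0),
    ENNReal.le_div_iff_mul_le (.inl hA0) (.inl hA.measure_lt_top.ne)]
  calc (Measure.modularCharacterFun k : ℝ≥0∞) * μ A
      = Measure.map (· * k) μ A := by
        rw [Measure.measure_isMulInvariant_eq_smul_of_isCompact_closure
            (Measure.map (· * k) μ) μ hA.closure,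
          Measure.modularCharacterFun_eq_haarScalarFactor μ]
        rfl
    _ = μ ((· * k) ⁻¹' A) := Measure.map_apply (measurable_mul_const k) hAc.measurableSet
    _ ≤ μ (A * K⁻¹) := by
        exact measure_mono fun u hu =>
          ⟨u * k, hu, k⁻¹, Set.inv_mem_inv.2 hk, mul_inv_cancel_right u k⟩

variable [SecondCountableTopology G] [MeasurableSpace G] [BorelSpace G]

theorem lintegral_mul_right_eq_modularCharacterFun_mul (μ : Measure G) [μ.IsHaarMeasure] (k : G)
    {φ : G → ℝ≥0∞} (hφ : Measurable φ) :
    ∫⁻ u, φ (u * k) ∂μ = Measure.modularCharacterFun k * ∫⁻ u, φ u ∂μ := by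
  rw [← lintegral_map hφ (measurable_mul_const k),
    Measure.isMulLeftInvariant_eq_smul (Measure.map (· * k) μ) μ,
    ← Measure.modularCharacterFun_eq_haarScalarFactor, lintegral_smul_measure]
  rfl

theorem exists_setLIntegral_le_mul_setLIntegral_mul_right (μ : Measure G) [μ.IsHaarMeasure]
    {A K : Set G} (hA : IsCompact A) (hK : IsCompact K) :
    ∃ c : ℝ≥0, ∃ Q : Set G, IsCompact Q ∧ MeasurableSet Q ∧ ∀ k ∈ K, ∀ φ : G → ℝ≥0∞, Measurable φ →
      ∫⁻ u in A, φ u ∂μ ≤ c * ∫⁻ h in Q, φ (h * k) ∂μ := by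
  obtain ⟨c, hc⟩ := bddAbove_modularCharacterFun_image hK.inv
  refine ⟨c, closure (closure A * K⁻¹), (hA.closure.mul hK.inv).closure,
    isClosed_closure.measurableSet, fun k hk φ hφ => ?_⟩
  have hAm : MeasurableSet (closure A) := isClosed_closure.measurableSet
  have hsub : (· * k) ⁻¹' closure A ⊆ closure (closure A * K⁻¹) := fun h hh =>
    subset_closure ⟨h * k, hh, k⁻¹, Set.inv_mem_inv.2 hk, mul_inv_cancel_right h k⟩
  calc ∫⁻ u in A, φ u ∂μ
      ≤ ∫⁻ u in closure A, φ u ∂μ := lintegral_mono_set subset_closure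
    _ = ∫⁻ u, (closure A).indicator φ (u * k⁻¹ * k) ∂μ := by
        simp only [inv_mul_cancel_right, lintegral_indicator hAm]
    _ = Measure.modularCharacterFun k⁻¹ * ∫⁻ h, (closure A).indicator φ (h * k) ∂μ :=
        lintegral_mul_right_eq_modularCharacterFun_mul μ k⁻¹
          (φ := fun h => (closure A).indicator φ (h * k))
          ((hφ.indicator hAm).comp (measurable_mul_const k))
    _ = Measure.modularCharacterFun k⁻¹ * ∫⁻ h in (· * k) ⁻¹' closure A, φ (h * k) ∂μ := by
        rw [← lintegral_indicator (measurable_mul_const k hAm)]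
        rfl
    _ ≤ c * ∫⁻ h in closure (closure A * K⁻¹), φ (h * k) ∂μ := by
        gcongr
        exact hc ⟨k⁻¹, Set.inv_mem_inv.2 hk, rfl⟩

end Haar

theorem IsEvanescentSet.of_finite {G Y : Type*} [SMul G Y] [MetricSpace Y] {Q : Set G} {T : Set Y}
    (hQ : Q.Finite) (h : ∀ g ∈ Q, IsEvanescentSet {g} T) : IsEvanescentSet Q T := by
  choose! K hK using h
  obtain ⟨R, hR⟩ := (hQ.image K).bddAbove
  exact ⟨R, fun g hg x hx => (hK g hg g rfl x hx).trans (hR ⟨g, hg, rfl⟩)⟩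

section Induced

variable {G : Type*} [Group G] [TopologicalSpace G] [MeasurableSpace G]
  {Γ : Subgroup G} {μ : Measure G}

instance RightFundamentalDomain.isProbabilityMeasure_restrict (F : RightFundamentalDomain Γ μ) :
    IsProbabilityMeasure (μ.restrict F.carrier) :=
  ⟨by rw [Measure.restrict_apply_univ, F.measure_eq_one]⟩

namespace InducedSpace

variable {F : RightFundamentalDomain Γ μ} {X : Type*} [MetricSpace X] [MulAction Γ X]

/-- `x` is an approximate value of `f` with error `M`: for every `γ`, the map `u ↦ γ • f u` is at
`L^2` distance on the fundamental domain at most `M γ` from the constant map `x`. Such points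
represent `f` in `X`: the bounds for `γ ≠ 1` are what controls their displacements. -/
def IsApproxValue (M : Γ → ℝ≥0) (f : InducedSpace F X) (x : X) : Prop :=
  ∀ γ : Γ, lpEDist 2 (μ.restrict F.carrier) (fun u => γ • f.1 u) (fun _ => x) ≤ M γ

theorem IsApproxValue.lpEDist_le {M : Γ → ℝ≥0} {f : InducedSpace F X} {x : X}
    (hx : IsApproxValue M f x) :
    lpEDist 2 (μ.restrict F.carrier) f.1 (fun _ => x) ≤ M 1 := by
  simpa only [one_smul] using hx 1

theorem IsApproxValue.nndist_smul_le [IsIsometricSMul Γ X] {M : Γ → ℝ≥0} {f : InducedSpace F X}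
    {x : X} (hx : IsApproxValue M f x) (γ : Γ) : nndist (γ • x) x ≤ M 1 + M γ := by
  rw [← edist_le_coe, ENNReal.coe_add]
  exact (edist_smul_le_lpEDist_add f.1.aestronglyMeasurable.restrict one_le_two γ x).trans
    (add_le_add hx.lpEDist_le (hx γ))

variable [IsTopologicalGroup G] [BorelSpace G] [SecondCountableTopology G] [LocallyCompactSpace G]
  [μ.IsHaarMeasure] [DiscreteTopology Γ]

theorem edist_eq_lpEDist (f f' : InducedSpace F X) :
    edist f f' = lpEDist 2 (μ.restrict F.carrier) f.1 f'.1 := by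
  rw [edist_dist, dist_eq_eLpNorm, ENNReal.ofReal_toReal (memLp_dist f f').eLpNorm_ne_top]
  refine eLpNorm_congr_enorm_ae (.of_forall fun g => ?_)
  rw [Real.enorm_of_nonneg dist_nonneg, ← edist_dist, enorm_eq_self]

theorem IsApproxValue.nndist_le {M M' : Γ → ℝ≥0} {f f' : InducedSpace F X} {x x' : X}
    (hx : IsApproxValue M f x) (hx' : IsApproxValue M' f' x') :
    nndist f f' ≤ M 1 + nndist x x' + M' 1 := by
  rw [← edist_le_coe, edist_eq_lpEDist]
  refine (lpEDist_le_add_edist_add f.1.aestronglyMeasurable.restrict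
    f'.1.aestronglyMeasurable.restrict one_le_two x x').trans ?_
  rw [ENNReal.coe_add, ENNReal.coe_add, ← edist_nndist]
  gcongr
  · exact hx.lpEDist_le
  · exact hx'.lpEDist_le

variable [IsIsometricSMul Γ X]

theorem edist_inv_smul_eq_lpEDist (h : G) (f : InducedSpace F X) :
    edist (h⁻¹ • f) f = lpEDist 2 (μ.restrict F.carrier) (fun g => f.1 (h * g)) f.1 := by
  rw [edist_eq_lpEDist]
  refine lpEDist_congr_left (ae_restrict_of_ae ?_) _
  have htranslate : ∀ᵐ g ∂μ, (h⁻¹ • f).1 g = f.1 (h⁻¹⁻¹ * g) :=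
    AEEqFun.coeFn_compMeasurePreserving f.1 (measurePreserving_mul_left μ h⁻¹⁻¹)
  simpa only [inv_inv] using htranslate

variable (F X) in
theorem exists_lintegral_lpEDist_smul_const_sq_le (γ : Γ) :
    ∃ c : ℝ≥0, ∃ Q : Set G, IsCompact Q ∧ MeasurableSet Q ∧ ∀ f : InducedSpace F X,
      ∫⁻ g in F.carrier,
          lpEDist 2 (μ.restrict F.carrier) (fun u => γ • f.1 u) (fun _ => f.1 g) ^ 2 ∂μ ≤
        c * ∫⁻ h in Q, edist (h⁻¹ • f) f ^ 2 ∂μ := by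
  obtain ⟨c, Q, hQ, hQm, hle⟩ := exists_setLIntegral_le_mul_setLIntegral_mul_right μ
    F.isCompact_closure (F.isCompact_closure.image (continuous_mul_const (γ : G)))
  refine ⟨c, Q, hQ, hQm, fun f => ?_⟩
  have hf := f.1.stronglyMeasurable
  have hmeas : Measurable fun p : G × G => edist (f.1 (p.2 * p.1)) (f.1 p.1) ^ 2 :=
    ((hf.comp_measurable (measurable_snd.mul measurable_fst)).edist
      (hf.comp_measurable measurable_fst)).measurable.pow_const 2
  have hbound (g : G) (hg : g ∈ F.carrier) :
      lpEDist 2 (μ.restrict F.carrier) (fun u => γ • f.1 u) (fun _ => f.1 g) ^ 2 ≤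
        c * ∫⁻ h in Q, edist (f.1 (h * g)) (f.1 g) ^ 2 ∂μ := by
    have hequiv : ∀ᵐ u ∂μ.restrict F.carrier, γ • f.1 u = f.1 (u * (γ : G)⁻¹) :=
      ae_restrict_of_ae ((f.2.1 γ).mono fun _ => Eq.symm)
    have hm : Measurable fun u => edist (f.1 (u * (γ : G)⁻¹)) (f.1 g) ^ 2 :=
      ((hf.comp_measurable (measurable_mul_const _)).edist
        stronglyMeasurable_const).measurable.pow_const 2
    rw [lpEDist_congr_left hequiv, lpEDist_two_sq]
    refine (lintegral_mono_set subset_closure).trans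
      ((hle _ (mem_image_of_mem (· * (γ : G)) (subset_closure hg)) _ hm).trans_eq ?_)
    simp only [← mul_assoc, mul_inv_cancel_right]
  calc ∫⁻ g in F.carrier,
        lpEDist 2 (μ.restrict F.carrier) (fun u => γ • f.1 u) (fun _ => f.1 g) ^ 2 ∂μ
      ≤ ∫⁻ g in F.carrier, c * ∫⁻ h in Q, edist (f.1 (h * g)) (f.1 g) ^ 2 ∂μ ∂μ :=
        setLIntegral_mono' F.measurableSet hbound
    _ = c * ∫⁻ h in Q, ∫⁻ g in F.carrier, edist (f.1 (h * g)) (f.1 g) ^ 2 ∂μ ∂μ := by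
        rw [lintegral_const_mul _ hmeas.lintegral_prod_right',
          lintegral_lintegral_swap (f := fun g h => edist (f.1 (h * g)) (f.1 g) ^ 2)
            hmeas.aemeasurable]
    _ = c * ∫⁻ h in Q, edist (h⁻¹ • f) f ^ 2 ∂μ := by
        simp only [edist_inv_smul_eq_lpEDist, lpEDist_two_sq]

theorem exists_lintegral_lpEDist_smul_const_sq_le_of_isEvanescentSet {T : Set (InducedSpace F X)}
    (hT : ∀ Q : Set G, IsCompact Q → IsEvanescentSet Q T) (γ : Γ) :
    ∃ C : ℝ≥0, ∀ f ∈ T, ∫⁻ g in F.carrier,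
      lpEDist 2 (μ.restrict F.carrier) (fun u => γ • f.1 u) (fun _ => f.1 g) ^ 2 ∂μ ≤ C := by
  obtain ⟨c, Q, hQ, hQm, hle⟩ := exists_lintegral_lpEDist_smul_const_sq_le F X γ
  obtain ⟨K, hK⟩ := hT Q⁻¹ hQ.inv
  have hdisp (f) (hf : f ∈ T) (h) (hh : h ∈ Q) : edist (h⁻¹ • f) f ≤ K.toNNReal := by
    rw [edist_dist]
    exact ENNReal.ofReal_le_ofReal (hK _ (Set.inv_mem_inv.2 hh) f hf)
  refine ⟨c * (K.toNNReal ^ 2 * (μ Q).toNNReal), fun f hf => (hle f).trans ?_⟩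
  calc c * ∫⁻ h in Q, edist (h⁻¹ • f) f ^ 2 ∂μ
      ≤ c * ∫⁻ _ in Q, (K.toNNReal : ℝ≥0∞) ^ 2 ∂μ := by
        gcongr c * ?_
        refine setLIntegral_mono' hQm fun h hh => ?_
        gcongr
        exact hdisp f hf h hh
    _ = _ := by
        rw [setLIntegral_const]
        push_cast
        rw [ENNReal.coe_toNNReal hQ.measure_lt_top.ne]

theorem exists_forall_exists_isApproxValue {T : Set (InducedSpace F X)}
    (hT : ∀ Q : Set G, IsCompact Q → IsEvanescentSet Q T) :
    ∃ M : Γ → ℝ≥0, ∀ f ∈ T, ∃ x : X, IsApproxValue M f x := by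
  have : Countable Γ := TopologicalSpace.separableSpace_iff_countable.1 inferInstance
  choose C hC using exists_lintegral_lpEDist_smul_const_sq_le_of_isEvanescentSet hT
  obtain ⟨M, hM⟩ := exists_forall_le_of_lintegral_le (μ.restrict F.carrier) C
  refine ⟨fun γ => NNReal.sqrt (M γ), fun f hf => ?_⟩
  have hmeas (γ : Γ) : Measurable fun g =>
      lpEDist 2 (μ.restrict F.carrier) (fun u => γ • f.1 u) (fun _ => f.1 g) ^ 2 := by
    have hs := f.1.stronglyMeasurable
    have hγs := (isometry_smul X γ).continuous.comp_stronglyMeasurable hs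
    simp only [lpEDist_two_sq]
    exact Measurable.lintegral_prod_right' (f := fun p : G × G => edist (γ • f.1 p.2) (f.1 p.1) ^ 2)
      (((hγs.comp_measurable measurable_snd).edist
        (hs.comp_measurable measurable_fst)).measurable.pow_const 2)
  obtain ⟨g, hg⟩ := hM _ (fun γ => (hmeas γ).aemeasurable) (fun γ => hC γ f hf)
  refine ⟨f.1 g, fun γ => (ENNReal.pow_le_pow_left_iff two_ne_zero).1 ?_⟩
  simpa only [← ENNReal.coe_pow, NNReal.sq_sqrt] using hg γ

end InducedSpace

end Induced

theorem mainTheorem7_general {G : Type*} [Group G] [TopologicalSpace G] [IsTopologicalGroup G]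
    [LocallyCompactSpace G] [SecondCountableTopology G] [MeasurableSpace G] [BorelSpace G]
    (Γ : Subgroup G) [DiscreteTopology Γ] (μ : Measure G) [μ.IsHaarMeasure]
    (F : RightFundamentalDomain Γ μ) {X : Type*} [MetricSpace X] [MulAction Γ X]
    [IsIsometricSMul Γ X] (h : IsEvanescent G (InducedSpace F X)) :
    IsEvanescent Γ X := by
  obtain ⟨T, hTunb, hT⟩ := h
  obtain ⟨M, hM⟩ := InducedSpace.exists_forall_exists_isApproxValue hT
  refine ⟨{x | ∃ f ∈ T, InducedSpace.IsApproxValue M f x}, fun hbdd => hTunb ?_,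
    fun Q hQ => .of_finite hQ.finite_of_discrete fun γ _ => ?_⟩
  · obtain ⟨R, hR⟩ := Metric.isBounded_iff_nndist.1 hbdd
    refine Metric.isBounded_iff_nndist.2 ⟨M 1 + R + M 1, fun f hf f' hf' => ?_⟩
    obtain ⟨x, hx⟩ := hM f hf
    obtain ⟨x', hx'⟩ := hM f' hf'
    have hxx' : nndist x x' ≤ R := hR ⟨f, hf, hx⟩ ⟨f', hf', hx'⟩
    exact (hx.nndist_le hx').trans (by gcongr)
  · refine ⟨(M 1 + M γ : ℝ≥0), ?_⟩
    rintro _ rfl x ⟨f, -, hx⟩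
    exact hx.nndist_smul_le _

theorem mainTheorem7 {G : Type*} [Group G] [TopologicalSpace G] [IsTopologicalGroup G]
    [T2Space G] [LocallyCompactSpace G] [SecondCountableTopology G]
    [MeasurableSpace G] [BorelSpace G]
    (Γ : Subgroup G) [DiscreteTopology Γ] [CompactSpace (G ⧸ Γ)]
    (μ : MeasureTheory.Measure G) [μ.IsHaarMeasure] (F : RightFundamentalDomain Γ μ)
    {X : Type*} [MetricSpace X] [CompleteSpace X] [TopologicalSpace.SeparableSpace X] [IsCAT0 X]
    [MulAction Γ X] [IsIsometricSMul Γ X]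
    (h : IsEvanescent G (InducedSpace F X)) :
    IsEvanescent Γ X := by
  exact mainTheorem7_general Γ μ F h
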